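/- Let $\mathcal N$ be a countable index set and let $\ell^q=\ell^q(\mathcal N)$, $1\le q\le\infty$, be the space of real $q$-summable (bounded, if $q=\infty$) families $(x(n))_{n\in\mathcal N}$ with norm $\|\cdot\|_q$. Let $\mathcal B(\ell^q)$ be the algebra of bounded linear operators on $\ell^q$ with the operator norm. Let $\mathcal A$ be a Banach algebra of infinite matrices $A=(a(i,j))_{i,j\in\mathcal N}$: a real Banach space of such matrices, closed under matrix multiplication, with $\|AB\|_{\mathcal A}\le K\|A\|_{\mathcal A}\|B\|_{\mathcal A}$ for some constant $K$. Suppose that, for every $1\le q\le\infty$, $\mathcal A$ is a Banach subalgebra of $\mathcal B(\ell^q)$: each $A\in\mathcal A$ acts on $\ell^q$ by $(Ax)(i)=\sum_j a(i,j)x(j)$ as a bounded operator, and $\sup_{\|A\|_{\mathcal A}\le1}\|A\|_{\mathcal B(\ell^q)}<\infty$. Suppose further that * $\mathcal A$ admits norm control in $\mathcal B(\ell^2)$: there is a continuous $h:[0,\infty)^2\to[0,\infty)$ such that every $A\in\mathcal A$ that is invertible in $\mathcal B(\ell^2)$ satisfies $A^{-1}\in\mathcal A$ and $\|A^{-1}\|_{\mathcal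 A}\le h(\|A\|_{\mathcal A},\|A^{-1}\|_{\mathcal B(\ell^2)})$; * there are finite sets $\mathcal N_1\subset\mathcal N_2\subset\cdots$ with $\bigcup_m\mathcal N_m=\mathcal N$ such that the projections $P_mx=(x(n)\chi_{\mathcal N_m}(n))_{n\in\mathcal N}$ satisfy $\lim_{m\to\infty}\sup_{\|A\|_{\mathcal A}\le1}\|P_mA(I-P_{m+1})\|_{\mathcal B(\ell^\infty)}=0$. Let $2\le p_0\le\infty$ and $1\le p\le p_0$. For a map $f:\ell^{p_0}\to\ell^{p_0}$, the gradient $\nabla f(x)$ is defined by $\nabla f(x)c=\lim_{t\to0}(f(x+tc)-f(x))/t$ (limit in $\ell^{p_0}$) for $x,c\in\ell^{p_0}$. Let $f:\ell^{p_0}\to\ell^{p_0}$ be continuous with $f(0)=0$. Assume that $\nabla f(x)$ exists and belongs to $\mathcal A$ for every $x\in\ell^{p_0}$, that $x\mapsto\nabla f(x)$ is bounded and continuous from $\ell^{p_0}$ to $\mathcal A$, and that for some $m_0>0$ $$c^T\nabla f(x)c\ge m_0\,c^Tc\qquad\text{for all }c\in\ell^2,\ x\in\ell^{p_0}.$$ Then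 $f$ is a bijection of $\ell^{p_0}$ onto itself, and its inverse $f^{-1}$ has a gradient $\nabla f^{-1}(z)\in\mathcal A$ at every $z\in\ell^{p_0}$ with $\sup_{z\in\ell^{p_0}}\|\nabla f^{-1}(z)\|_{\mathcal A}<\infty$. Moreover, if $y,\epsilon\in\ell^p$ and $x_0,x_\epsilon\in\ell^{p_0}$ satisfy $f(x_0)=y$ and $f(x_\epsilon)=y+\epsilon$, then $x_0,x_\epsilon\in\ell^p$, $$\|x_\epsilon-x_0\|_p\le\Big(\sup_{z\in\ell^{p_0}}\|\nabla f^{-1}(z)\|_{\mathcal A}\Big)\Big(\sup_{\|A\|_{\mathcal A}\le1}\|A\|_{\mathcal B(\ell^p)}\Big)\|\epsilon\|_p,$$ and, if $y\ne0$, then $x_0\ne0$ and $$\frac{\|x_\epsilon-x_0\|_p}{\|x_0\|_p}\le\kappa_{\mathcal A}(f)\Big(\sup_{\|A\|_{\mathcal A}\le1}\|A\|_{\mathcal B(\ell^p)}\Big)^2\frac{\|\epsilon\|_p}{\|y\|_p},$$ where $\kappa_{\mathcal A}(f)=\big(\sup_{z\in\ell^{p_0}}\|\nabla f(z)\|_{\mathcal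 A}\big)\big(\sup_{z\in\ell^{p_0}}\|\nabla f^{-1}(z)\|_{\mathcal A}\big)$. -/

import Mathlib

open Filter Topology
open scoped ENNReal NNReal

noncomputable section

/-- The space `ℓ^q(𝒩)` of real `q`-summable (bounded, if `q = ∞`) families indexed by `𝒩`. -/
abbrev Ell (𝒩 : Type*) (q : ℝ≥0∞) : Type _ := lp (fun _ : 𝒩 => ℝ) q

/-- The space `ℬ(ℓ^q(𝒩))` of bounded linear operators on `ℓ^q(𝒩)`, with the operator norm. -/
abbrev BEll (𝒩 : Type*) (q : ℝ≥0∞) [Fact (1 ≤ q)] : Type _ := Ell 𝒩 q →L[ℝ] Ell 𝒩 q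

/-- The Banach space `𝒜` is a Banach algebra of infinite matrices indexed by `𝒩` that is a Banach
subalgebra of `ℬ(ℓ^q(𝒩))` for all `1 ≤ q ≤ ∞`: its elements are matrices (`entries`), the matrix
product of two elements is again an element, with a norm that is submultiplicative up to a
constant, and every element `A` acts on each `ℓ^q` through `(A x)(i) = ∑ j, A(i,j) x(j)` as a
bounded operator (`op q A`), where `op q : 𝒜 → ℬ(ℓ^q)` is bounded.
The operators are determined by the matrices. No unit is required. -/
structure MatrixAlgebra (𝒩 : Type*) (𝒜 : Type*) [NormedAddCommGroup 𝒜] [NormedSpace ℝ 𝒜] where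
  /-- the matrix `(A(i,j))` of an element `A` -/
  entries : 𝒜 →ₗ[ℝ] Matrix 𝒩 𝒩 ℝ
  entries_injective : Function.Injective entries
  /-- the operator on `ℓ^q` given by the matrix of an element -/
  op : ∀ (q : ℝ≥0∞) [Fact (1 ≤ q)], 𝒜 →L[ℝ] BEll 𝒩 q
  op_hasSum : ∀ (q : ℝ≥0∞) [Fact (1 ≤ q)] (A : 𝒜) (x : Ell 𝒩 q) (i : 𝒩),
    HasSum (fun j => entries A i j * x j) (op q A x i)
  exists_mul : ∃ K : ℝ, ∀ A B : 𝒜, ∃ C : 𝒜,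
    (∀ i j, HasSum (fun k => entries A i k * entries B k j) (entries C i j)) ∧
      ‖C‖ ≤ K * ‖A‖ * ‖B‖

/-- The truncation `(P x)(n) = x(n)` for `n ∈ s` and `(P x)(n) = 0` otherwise, on `ℓ^∞`. -/
def truncation {𝒩 : Type*} (s : Finset 𝒩) : BEll 𝒩 ∞ :=
  LinearMap.mkContinuous
    { toFun := fun x =>
        ⟨(s : Set 𝒩).indicator x, by
          refine memℓp_infty ⟨‖x‖, ?_⟩
          rintro _ ⟨i, rfl⟩
          exact (norm_indicator_le_norm_self _ _).trans (lp.norm_apply_le_norm (by simp) x i)⟩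
      map_add' := fun x y => by
        ext i
        exact congrFun (Set.indicator_add (s : Set 𝒩) x y) i
      map_smul' := fun c x => by
        ext i
        exact congrFun (Set.indicator_const_smul (s : Set 𝒩) c x) i }
    1 (fun x => by
      rw [one_mul]
      refine lp.norm_le_of_forall_le (norm_nonneg x) fun i => ?_
      exact (norm_indicator_le_norm_self _ _).trans (lp.norm_apply_le_norm (by simp) x i))

namespace MatrixAlgebra

variable {𝒩 𝒜 : Type*} [NormedAddCommGroup 𝒜] [NormedSpace ℝ 𝒜] (S : MatrixAlgebra 𝒩 𝒜)

/-- `𝒜` is inverse-closed in `ℬ(ℓ²)` and admits norm control there: for some continuous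
`h : [0,∞) × [0,∞) → [0,∞)`, whenever `A ∈ 𝒜` has an inverse `T` in `ℬ(ℓ²)`, this inverse is given
by an element of `𝒜`, of `𝒜`-norm at most `h (‖A‖_𝒜, ‖T‖)`. -/
def AdmitsNormControl : Prop :=
  ∃ h : ℝ≥0 × ℝ≥0 → ℝ≥0, Continuous h ∧
    ∀ (A : 𝒜) (T : BEll 𝒩 2), S.op 2 A * T = 1 → T * S.op 2 A = 1 →
      ∃ B : 𝒜, S.op 2 B = T ∧ ‖B‖₊ ≤ h (‖A‖₊, ‖T‖₊)

/-- For some nested finite sets `𝒩_m` that exhaust `𝒩`, with truncations `P_m`,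
`sup_{‖A‖_𝒜 ≤ 1} ‖P_m A (I - P_{m+1})‖_{ℬ(ℓ^∞)} → 0` as `m → ∞`. -/
def OffDiagonalDecay : Prop :=
  ∃ N : ℕ → Finset 𝒩, Monotone N ∧ (∀ n, ∃ m, n ∈ N m) ∧
    Tendsto (fun m => ⨆ A : {A : 𝒜 // ‖A‖ ≤ 1},
      ‖truncation (N m) * S.op ∞ A.1 * (1 - truncation (N (m + 1)))‖) atTop (𝓝 0)

/-- `D x ∈ 𝒜` is the gradient of `f : ℓ^q → ℓ^q` at every `x ∈ ℓ^q`, that is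
`(f (x + t c) - f x) / t → (D x) c` in `ℓ^q` as `t → 0`, for all `x, c ∈ ℓ^q`. -/
def HasGradient {q : ℝ≥0∞} [Fact (1 ≤ q)] (f : Ell 𝒩 q → Ell 𝒩 q) (D : Ell 𝒩 q → 𝒜) : Prop :=
  ∀ x c : Ell 𝒩 q,
    Tendsto (fun t : ℝ => t⁻¹ • (f (x + t • c) - f x)) (𝓝[≠] 0) (𝓝 (S.op q (D x) c))

/-- The constant `sup_{‖A‖_𝒜 ≤ 1} ‖A‖_{ℬ(ℓ^p)}`. -/
def embConst (p : ℝ≥0∞) [Fact (1 ≤ p)] : ℝ :=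
  ⨆ A : {A : 𝒜 // ‖A‖ ≤ 1}, ‖S.op p A.1‖

end MatrixAlgebra

/-- `sup_z ‖D z‖_𝒜`. -/
def supNorm {X 𝒜 : Type*} [NormedAddCommGroup 𝒜] (D : X → 𝒜) : ℝ := ⨆ z, ‖D z‖

/-- The condition number `κ_𝒜(f) = (sup_z ‖∇f(z)‖_𝒜) (sup_z ‖∇f⁻¹(z)‖_𝒜)` of a map with gradient
`D` whose inverse has gradient `G`. -/
def condNumber {X 𝒜 : Type*} [NormedAddCommGroup 𝒜] (D G : X → 𝒜) : ℝ := supNorm D * supNorm G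

end

/-- The variational principle of Ekeland and Caristi, for continuous functions. -/
theorem exists_forall_eq_of_add_mul_dist_le {X : Type*} [MetricSpace X] [CompleteSpace X]
    [Nonempty X] {φ : X → ℝ} (hφ : Continuous φ) (h0 : ∀ x, 0 ≤ φ x) {a : ℝ} (ha : 0 < a) :
    ∃ x, ∀ x', φ x' + a * dist x x' ≤ φ x → x' = x := by
  have step : ∀ (n : ℕ) (x : X), ∃ x', φ x' + a * dist x x' ≤ φ x ∧
      ∀ w, φ w + a * dist x w ≤ φ x → φ x' ≤ φ w + (1 / 2 : ℝ) ^ n := by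
    intro n x
    set s : Set ℝ := φ '' {w | φ w + a * dist x w ≤ φ x} with hs
    have hne : s.Nonempty := ⟨φ x, x, by simp, rfl⟩
    have hbdd : BddBelow s := ⟨0, by rintro _ ⟨w, -, rfl⟩; exact h0 w⟩
    obtain ⟨_, ⟨x', hx', rfl⟩, hlt⟩ :=
      exists_lt_of_csInf_lt hne
        (lt_add_of_pos_right (sInf s) (show (0 : ℝ) < (1 / 2) ^ n by positivity))
    refine ⟨x', hx', fun w hw => hlt.le.trans ?_⟩
    gcongr
    exact csInf_le hbdd ⟨w, hw, rfl⟩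
  choose next hnext hmin using step
  have trans : ∀ x y z, φ y + a * dist x y ≤ φ x → φ z + a * dist y z ≤ φ y →
      φ z + a * dist x z ≤ φ x := by
    intro x y z hxy hyz
    have := mul_le_mul_of_nonneg_left (dist_triangle x y z) ha.le
    linarith
  let u : ℕ → X := fun n => Nat.rec (Classical.arbitrary X) (fun k x => next k x) n
  have hu : ∀ n m, n ≤ m → φ (u m) + a * dist (u n) (u m) ≤ φ (u n) := by
    intro n m hnm
    induction m, hnm using Nat.le_induction with
    | base => simp
    | succ m _ ih => exact trans _ _ _ ih (hnext m (u m))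
  have hanti : Antitone fun n => φ (u n) := fun n m hnm => by
    have := hu n m hnm
    have : 0 ≤ a * dist (u n) (u m) := by positivity
    linarith
  have hlim := tendsto_atTop_ciInf hanti ⟨0, by rintro _ ⟨n, rfl⟩; exact h0 _⟩
  set ℓ := ⨅ n, φ (u n)
  have hℓ : ∀ n, ℓ ≤ φ (u n) := fun n => hanti.le_of_tendsto hlim n
  have hcauchy : CauchySeq u := by
    refine cauchySeq_of_le_tendsto_0' (fun n => (φ (u n) - ℓ) / a) (fun n m hnm => ?_) ?_
    · rw [le_div_iff₀ ha]
      linarith [hu n m hnm, hℓ m]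
    · simpa using (hlim.sub_const ℓ).div_const a
  obtain ⟨x, hx⟩ := cauchySeq_tendsto_of_complete hcauchy
  have hux : ∀ n, φ x + a * dist (u n) x ≤ φ (u n) := fun n =>
    le_of_tendsto (((hφ.tendsto x).comp hx).add ((tendsto_const_nhds.dist hx).const_mul a))
      (eventually_atTop.2 ⟨n, fun m hm => hu n m hm⟩)
  refine ⟨x, fun x' hx' => ?_⟩
  have hle : φ x ≤ φ x' := by
    have h1 : ∀ n, φ x ≤ φ x' + (1 / 2 : ℝ) ^ n := fun n => by
      have h2 := hmin n (u n) x' (trans _ _ _ (hux n) hx')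
      have h3 := hux (n + 1)
      have h4 : 0 ≤ a * dist (u (n + 1)) x := by positivity
      have h5 : φ (u (n + 1)) ≤ φ x' + (1 / 2 : ℝ) ^ n := h2
      linarith
    have h2 : Tendsto (fun n : ℕ => φ x' + (1 / 2 : ℝ) ^ n) atTop (𝓝 (φ x' + 0)) :=
      (tendsto_pow_atTop_nhds_zero_of_lt_one (by norm_num) (by norm_num)).const_add _
    simpa using ge_of_tendsto' h2 h1
  have h1 : a * dist x x' ≤ 0 := by linarith
  have h2 : dist x x' ≤ 0 := nonpos_of_mul_nonpos_right h1 ha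
  exact (dist_le_zero.1 h2).symm

/-- A continuous map of Banach spaces whose directional derivatives have uniformly bounded right
inverses is surjective. -/
theorem surjective_of_tendsto_slope {E F : Type*} [NormedAddCommGroup E] [NormedSpace ℝ E]
    [CompleteSpace E] [NormedAddCommGroup F] [NormedSpace ℝ F] {f : E → F} (hf : Continuous f)
    {L : E → E → F}
    (hL : ∀ x c, Tendsto (fun t : ℝ => t⁻¹ • (f (x + t • c) - f x)) (𝓝[≠] 0) (𝓝 (L x c)))
    {R : ℝ} (hR0 : 0 < R) (hR : ∀ x v, ∃ c, L x c = v ∧ ‖c‖ ≤ R * ‖v‖) :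
    Function.Surjective f := by
  intro y
  obtain ⟨x, hx⟩ := exists_forall_eq_of_add_mul_dist_le (φ := fun x => ‖f x - y‖)
    (by fun_prop) (fun _ => norm_nonneg _) (a := 1 / (2 * R)) (by positivity)
  refine ⟨x, ?_⟩
  by_contra hne
  obtain ⟨c, hc, hcR⟩ := hR x (y - f x)
  have hv : 0 < ‖y - f x‖ := norm_pos_iff.2 (sub_ne_zero.2 (Ne.symm hne))
  have hlim := (hL x c).mono_left (nhdsGT_le_nhdsNE (0 : ℝ))
  rw [hc] at hlim
  have h1 := hlim.eventually (Metric.ball_mem_nhds (y - f x) (half_pos hv))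
  have h2 : ∀ᶠ t : ℝ in 𝓝[>] 0, t < 1 ∧ 0 < t :=
    (eventually_nhdsWithin_of_eventually_nhds (eventually_lt_nhds one_pos)).and
      self_mem_nhdsWithin
  obtain ⟨t, ht, ht1, ht0⟩ := (h1.and h2).exists
  set v := y - f x with hvdef
  set w := t⁻¹ • (f (x + t • c) - f x) with hwdef
  have hw : ‖w - v‖ < ‖v‖ / 2 := by simpa [dist_eq_norm] using ht
  have hfw : f (x + t • c) - y = t • (w - v) - (1 - t) • v := by
    have : t • w = f (x + t • c) - f x := by rw [hwdef, smul_inv_smul₀ ht0.ne']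
    rw [smul_sub, this, hvdef]
    module
  have hle : ‖f (x + t • c) - y‖ + 1 / (2 * R) * dist x (x + t • c) ≤ ‖f x - y‖ := by
    have e1 : ‖f (x + t • c) - y‖ ≤ t * (‖v‖ / 2) + (1 - t) * ‖v‖ := by
      rw [hfw]
      refine (norm_sub_le _ _).trans ?_
      rw [norm_smul, norm_smul, Real.norm_of_nonneg ht0.le, Real.norm_of_nonneg (by linarith)]
      gcongr
    have e2 : 1 / (2 * R) * dist x (x + t • c) ≤ t * (‖v‖ / 2) := by
      rw [dist_self_add_right, norm_smul, Real.norm_of_nonneg ht0.le]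
      calc 1 / (2 * R) * (t * ‖c‖) ≤ 1 / (2 * R) * (t * (R * ‖v‖)) := by gcongr
        _ = t * (‖v‖ / 2) := by field_simp
    rw [norm_sub_rev (f x) y]
    linarith
  have heq := hx _ hle
  have : w = 0 := by rw [hwdef, heq]; simp
  rw [this, zero_sub, norm_neg] at hw
  linarith

namespace MatrixAlgebra

variable {𝒩 𝒜 : Type*} [NormedAddCommGroup 𝒜] [NormedSpace ℝ 𝒜] (S : MatrixAlgebra 𝒩 𝒜)

theorem op_single (q : ℝ≥0∞) [Fact (1 ≤ q)] [DecidableEq 𝒩] (A : 𝒜) (i j : 𝒩) :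
    S.op q A (lp.single q j (1 : ℝ)) i = S.entries A i j := by
  refine (S.op_hasSum q A (lp.single q j (1 : ℝ)) i).unique ?_
  convert hasSum_single j ?_ using 1
  · simp
  · intro k hk
    simp [hk]

theorem op_injective (q : ℝ≥0∞) [Fact (1 ≤ q)] : Function.Injective (S.op q) := by
  classical
  intro A B h
  refine S.entries_injective (Matrix.ext fun i j => ?_)
  rw [← S.op_single q, ← S.op_single q, h]

theorem op_coe_eq {q r : ℝ≥0∞} [Fact (1 ≤ q)] [Fact (1 ≤ r)] (A : 𝒜) {x : Ell 𝒩 q} {y : Ell 𝒩 r}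
    (h : (x : 𝒩 → ℝ) = y) : (S.op q A x : 𝒩 → ℝ) = S.op r A y := by
  funext i
  have hx := S.op_hasSum q A x i
  rw [h] at hx
  exact hx.unique (S.op_hasSum r A y i)

theorem exists_hasSum_abs_entries (A : 𝒜) (i : 𝒩) :
    ∃ s ≤ ‖S.op ∞ A‖, HasSum (fun j => |S.entries A i j|) s := by
  have hb : ∀ j, ‖(SignType.sign (S.entries A i j) : ℝ)‖ ≤ 1 := fun j => by
    rcases lt_trichotomy (S.entries A i j) 0 with h | h | h <;> simp [h]
  let x : Ell 𝒩 ∞ := ⟨fun j => (SignType.sign (S.entries A i j) : ℝ),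
    memℓp_infty ⟨1, by rintro _ ⟨j, rfl⟩; exact hb j⟩⟩
  have hx : ‖x‖ ≤ 1 := lp.norm_le_of_forall_le zero_le_one hb
  refine ⟨S.op ∞ A x i, ?_, ?_⟩
  · calc S.op ∞ A x i ≤ ‖S.op ∞ A x i‖ := Real.le_norm_self _
      _ ≤ ‖S.op ∞ A x‖ := lp.norm_apply_le_norm (by simp) _ i
      _ ≤ ‖S.op ∞ A‖ * ‖x‖ := (S.op ∞ A).le_opNorm x
      _ ≤ ‖S.op ∞ A‖ := mul_le_of_le_one_right (norm_nonneg _) hx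
  · convert S.op_hasSum ∞ A x i using 2 with j
    exact (self_mul_sign _).symm

theorem op_eq_mul_of_hasSum {A B C : 𝒜}
    (h : ∀ i j, HasSum (fun k => S.entries A i k * S.entries B k j) (S.entries C i j))
    (q : ℝ≥0∞) [Fact (1 ≤ q)] : S.op q C = S.op q A * S.op q B := by
  ext x i
  have hx : ∀ j, |(x j : ℝ)| ≤ ‖x‖ := fun j =>
    lp.norm_apply_le_norm (zero_lt_one.trans_le (Fact.out : 1 ≤ q)).ne' x j
  have hB : ∀ k, ∃ s ≤ ‖S.op ∞ B‖, HasSum (fun j => |S.entries B k j|) s :=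
    S.exists_hasSum_abs_entries B
  choose s hs hsum using hB
  obtain ⟨a, -, ha⟩ := S.exists_hasSum_abs_entries A i
  set F : 𝒩 × 𝒩 → ℝ := fun z => S.entries A i z.1 * (S.entries B z.1 z.2 * x z.2) with hF
  have hrow : ∀ k, Summable fun j => |S.entries A i k| * (|S.entries B k j| * ‖x‖) := fun k =>
    ((hsum k).summable.mul_right _).mul_left _
  have hdom : Summable fun z : 𝒩 × 𝒩 =>
      |S.entries A i z.1| * (|S.entries B z.1 z.2| * ‖x‖) := by
    rw [summable_prod_of_nonneg (fun z => by positivity)]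
    refine ⟨hrow, ?_⟩
    refine Summable.of_nonneg_of_le (fun k => tsum_nonneg fun j => by positivity) (fun k => ?_)
      (ha.summable.mul_right (‖S.op ∞ B‖ * ‖x‖))
    change ∑' j, |S.entries A i k| * (|S.entries B k j| * ‖x‖) ≤ _
    rw [tsum_mul_left, tsum_mul_right, (hsum k).tsum_eq]
    gcongr
    exact hs k
  have hFs : Summable F := by
    refine Summable.of_norm_bounded hdom fun z => ?_
    rw [hF, norm_mul, norm_mul]
    simp only [Real.norm_eq_abs]
    gcongr
    exact hx _
  have h1 : HasSum (fun k => S.entries A i k * S.op q B x k) (∑' z, F z) :=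
    hFs.hasSum.prod_fiberwise fun k => (S.op_hasSum q B x k).mul_left _
  have h2 : HasSum (fun j => S.entries C i j * x j) (∑' z, F z) := by
    have hsw : HasSum (F ∘ Equiv.prodComm 𝒩 𝒩) (∑' z, F z) :=
      (Equiv.prodComm 𝒩 𝒩).hasSum_iff.2 hFs.hasSum
    refine hsw.prod_fiberwise fun j => ?_
    have hFk : ∀ k, (F ∘ Equiv.prodComm 𝒩 𝒩) (j, k) =
        S.entries A i k * S.entries B k j * x j := fun k => by simp [hF, mul_assoc]
    rw [funext hFk]
    exact (h i j).mul_right (x j)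
  rw [(S.op_hasSum q C x i).unique h2, mul_apply_eq_comp]
  exact h1.unique (S.op_hasSum q A (S.op q B x) i)

theorem exists_op_mul : ∃ K : ℝ, 0 ≤ K ∧ ∀ A B : 𝒜, ∃ C : 𝒜,
    (∀ (q : ℝ≥0∞) [Fact (1 ≤ q)], S.op q C = S.op q A * S.op q B) ∧ ‖C‖ ≤ K * ‖A‖ * ‖B‖ := by
  obtain ⟨K, hK⟩ := S.exists_mul
  refine ⟨max K 0, le_max_right _ _, fun A B => ?_⟩
  obtain ⟨C, hC, hn⟩ := hK A B
  refine ⟨C, fun q _ => S.op_eq_mul_of_hasSum hC q, hn.trans ?_⟩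
  gcongr
  exact le_max_left _ _

theorem op_eq_one {C : 𝒜} {r : ℝ≥0∞} [Fact (1 ≤ r)] (h : S.op r C = 1) (q : ℝ≥0∞)
    [Fact (1 ≤ q)] : S.op q C = 1 := by
  classical
  ext x i
  refine (S.op_hasSum q C x i).unique ?_
  have hent : ∀ j, S.entries C i j = if j = i then 1 else 0 := fun j => by
    rw [← S.op_single r, h]
    simp [Pi.single_apply, eq_comm]
  convert hasSum_single i ?_ using 1
  · simp [hent]
  · intro j hj
    simp [hent, hj]

/-- `B` is the inverse of `A` on all spaces `ℓ^q`. -/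
def IsInverse (A B : 𝒜) : Prop :=
  ∀ (q : ℝ≥0∞) [Fact (1 ≤ q)], S.op q A * S.op q B = 1 ∧ S.op q B * S.op q A = 1

variable {S}

theorem IsInverse.apply_apply {A B : 𝒜} (h : S.IsInverse A B) (q : ℝ≥0∞) [Fact (1 ≤ q)]
    (x : Ell 𝒩 q) : S.op q A (S.op q B x) = x := DFunLike.congr_fun (h q).1 x

theorem IsInverse.symm {A B : 𝒜} (h : S.IsInverse A B) : S.IsInverse B A := fun q _ => (h q).symm

variable (S) in
theorem isInverse_of_op {r : ℝ≥0∞} [Fact (1 ≤ r)] {A B : 𝒜} (h1 : S.op r A * S.op r B = 1)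
    (h2 : S.op r B * S.op r A = 1) : S.IsInverse A B := by
  obtain ⟨K, -, hK⟩ := S.exists_op_mul
  obtain ⟨C, hC, -⟩ := hK A B
  obtain ⟨C', hC', -⟩ := hK B A
  intro q _
  rw [← hC, ← hC']
  exact ⟨S.op_eq_one ((hC r).trans h1) q, S.op_eq_one ((hC' r).trans h2) q⟩

variable (S) in
theorem exists_norm_sub_le_of_isInverse : ∃ K : ℝ, 0 ≤ K ∧ ∀ A A' B B' : 𝒜, S.IsInverse A B →
    S.IsInverse A' B' → ‖B - B'‖ ≤ K * ‖B‖ * ‖B'‖ * ‖A - A'‖ := by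
  obtain ⟨K, hK0, hK⟩ := S.exists_op_mul
  refine ⟨K * K, by positivity, fun A A' B B' h h' => ?_⟩
  obtain ⟨C, hC, hCn⟩ := hK B (A' - A)
  obtain ⟨C', hC', hCn'⟩ := hK C B'
  have : B - B' = C' := by
    apply S.op_injective 2
    rw [hC', hC, map_sub, map_sub, mul_sub, sub_mul, (h 2).2, one_mul, mul_assoc, (h' 2).1,
      mul_one]
  rw [this]
  calc ‖C'‖ ≤ K * ‖C‖ * ‖B'‖ := hCn'
    _ ≤ K * (K * ‖B‖ * ‖A' - A‖) * ‖B'‖ := by gcongr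
    _ = K * K * ‖B‖ * ‖B'‖ * ‖A - A'‖ := by rw [norm_sub_rev]; ring

theorem tendsto_of_isInverse {X : Type*} {l : Filter X} {A B : X → 𝒜} {A' B' : 𝒜} {R : ℝ}
    (h : ∀ t, S.IsInverse (A t) (B t)) (hB : ∀ t, ‖B t‖ ≤ R) (h' : S.IsInverse A' B')
    (hA : Tendsto A l (𝓝 A')) : Tendsto B l (𝓝 B') := by
  obtain ⟨K, hK0, hK⟩ := S.exists_norm_sub_le_of_isInverse
  rw [tendsto_iff_norm_sub_tendsto_zero] at hA ⊢
  refine squeeze_zero (fun _ => norm_nonneg _) (fun t => (hK _ _ _ _ (h t) h').trans ?_)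
    (by simpa using hA.const_mul (K * R * ‖B'‖))
  gcongr
  exact hB t

end MatrixAlgebra

/-- Lax–Milgram: a strictly accretive operator is invertible. -/
theorem exists_inverse_of_le_inner {H : Type*} [NormedAddCommGroup H] [InnerProductSpace ℝ H]
    [CompleteSpace H] (A : H →L[ℝ] H) {m : ℝ} (hm : 0 < m)
    (hA : ∀ c, m * inner ℝ c c ≤ inner ℝ c (A c)) :
    ∃ T : H →L[ℝ] H, A * T = 1 ∧ T * A = 1 ∧ ‖T‖ ≤ m⁻¹ := by
  have hco : IsCoercive ((innerSL ℝ).comp A) := by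
    refine ⟨m, hm, fun u => ?_⟩
    have := hA u
    rw [real_inner_self_eq_norm_mul_norm, real_inner_comm, ← mul_assoc] at this
    simpa using this
  set e := hco.continuousLinearEquivOfBilin
  have he : ∀ v, e v = A v := fun v =>
    (hco.unique_continuousLinearEquivOfBilin fun w => by simp).symm
  have h1 : ∀ v, A (e.symm v) = v := fun v => by rw [← he, e.apply_symm_apply]
  refine ⟨e.symm, ContinuousLinearMap.ext h1, ContinuousLinearMap.ext fun v => ?_, ?_⟩
  · simp [← he]
  · refine ContinuousLinearMap.opNorm_le_bound _ (by positivity) fun v => ?_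
    change ‖e.symm v‖ ≤ _
    set c := e.symm v
    have h2 : m * (‖c‖ * ‖c‖) ≤ ‖c‖ * ‖v‖ := by
      have := hA c
      rw [h1, real_inner_self_eq_norm_mul_norm] at this
      exact this.trans (real_inner_le_norm _ _)
    rw [inv_mul_eq_div, le_div_iff₀ hm]
    rcases (norm_nonneg c).eq_or_lt with h | h
    · simp [← h]
    · nlinarith

namespace MatrixAlgebra

variable {𝒩 𝒜 : Type*} [NormedAddCommGroup 𝒜] [NormedSpace ℝ 𝒜] {S : MatrixAlgebra 𝒩 𝒜}

theorem AdmitsNormControl.exists_isInverse (hS : S.AdmitsNormControl) (M : ℝ) {m : ℝ}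
    (hm : 0 < m) : ∃ R : ℝ, 0 < R ∧ ∀ A : 𝒜, ‖A‖ ≤ M →
      (∀ c : Ell 𝒩 2, m * inner ℝ c c ≤ inner ℝ c (S.op 2 A c)) →
      ∃ B : 𝒜, S.IsInverse A B ∧ ‖B‖ ≤ R := by
  obtain ⟨h, hh, hinv⟩ := hS
  have hcpt : IsCompact (Set.Icc (0 : ℝ≥0) M.toNNReal ×ˢ Set.Icc (0 : ℝ≥0) m⁻¹.toNNReal) :=
    isCompact_Icc.prod isCompact_Icc
  obtain ⟨R, hR⟩ := (hcpt.image hh).bddAbove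
  refine ⟨R + 1, by positivity, fun A hA hacc => ?_⟩
  obtain ⟨T, h1, h2, hT⟩ := exists_inverse_of_le_inner (S.op 2 A) hm hacc
  obtain ⟨B, rfl, hB⟩ := hinv A T h1 h2
  refine ⟨B, S.isInverse_of_op h1 h2, ?_⟩
  have : ‖B‖₊ ≤ R := hB.trans (hR ⟨(‖A‖₊, ‖S.op 2 B‖₊), ⟨⟨zero_le, ?_⟩, zero_le, ?_⟩, rfl⟩)
  · have : ‖B‖ ≤ R := by exact_mod_cast this
    linarith
  · exact NNReal.le_toNNReal_of_coe_le hA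
  · exact NNReal.le_toNNReal_of_coe_le hT

end MatrixAlgebra

theorem norm_le_supNorm {X 𝒜 : Type*} [NormedAddCommGroup 𝒜] {D : X → 𝒜}
    (hD : BddAbove (Set.range fun z => ‖D z‖)) (z : X) : ‖D z‖ ≤ supNorm D :=
  le_ciSup hD z

theorem supNorm_nonneg {X 𝒜 : Type*} [NormedAddCommGroup 𝒜] (D : X → 𝒜) : 0 ≤ supNorm D :=
  Real.iSup_nonneg fun _ => norm_nonneg _

section Segment

variable {E 𝒜 : Type*} [NormedAddCommGroup E] [NormedSpace ℝ E] [NormedAddCommGroup 𝒜]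
  [NormedSpace ℝ 𝒜]

/-- The mean of `D` over the segment from `x` to `x + v`. -/
noncomputable def segmentMean (D : E → 𝒜) (x v : E) : 𝒜 := ∫ s in (0 : ℝ)..1, D (x + s • v)

theorem norm_segmentMean_le {D : E → 𝒜} {M : ℝ} (hM : ∀ z, ‖D z‖ ≤ M) (x v : E) :
    ‖segmentMean D x v‖ ≤ M := by
  simpa [segmentMean] using
    intervalIntegral.norm_integral_le_of_norm_le_const (a := (0 : ℝ)) (b := 1)
      (fun s _ => hM (x + s • v))

theorem segmentMean_zero [CompleteSpace 𝒜] (D : E → 𝒜) (x : E) : segmentMean D x 0 = D x := by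
  simp [segmentMean]

theorem continuous_segmentMean {D : E → 𝒜} (hD : Continuous D) (x : E) {v : ℝ → E}
    (hv : Continuous v) : Continuous fun t => segmentMean D x (v t) :=
  intervalIntegral.continuous_parametric_intervalIntegral_of_continuous'
    (f := fun t s => D (x + s • v t)) (by fun_prop) 0 1

theorem map_segmentMean [CompleteSpace 𝒜] {F : Type*} [NormedAddCommGroup F] [NormedSpace ℝ F]
    [CompleteSpace F] {D : E → 𝒜} (hD : Continuous D) (L : 𝒜 →L[ℝ] F) (x v : E) :
    L (segmentMean D x v) = ∫ s in (0 : ℝ)..1, L (D (x + s • v)) :=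
  (L.intervalIntegral_comp_comm (Continuous.intervalIntegrable (by fun_prop) _ _)).symm

end Segment

namespace MatrixAlgebra

variable {𝒩 𝒜 : Type*} [NormedAddCommGroup 𝒜] [NormedSpace ℝ 𝒜] {S : MatrixAlgebra 𝒩 𝒜}

variable (S) in
theorem norm_op_le (p : ℝ≥0∞) [Fact (1 ≤ p)] (A : 𝒜) : ‖S.op p A‖ ≤ S.embConst p * ‖A‖ := by
  have hbdd : BddAbove (Set.range fun A : {A : 𝒜 // ‖A‖ ≤ 1} => ‖S.op p A.1‖) := by
    refine ⟨‖S.op p‖, ?_⟩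
    rintro _ ⟨B, rfl⟩
    exact ((S.op p).le_opNorm _).trans (mul_le_of_le_one_right (norm_nonneg _) B.2)
  rcases eq_or_ne A 0 with rfl | hA
  · simp
  have hA' : 0 < ‖A‖ := norm_pos_iff.2 hA
  have hunit : ‖‖A‖⁻¹ • A‖ ≤ 1 := by
    rw [norm_smul, norm_inv, norm_norm, inv_mul_cancel₀ hA'.ne']
  have h : ‖S.op p (‖A‖⁻¹ • A)‖ ≤ S.embConst p := le_ciSup hbdd ⟨_, hunit⟩
  rwa [map_smul, norm_smul, norm_inv, norm_norm, inv_mul_eq_div, div_le_iff₀ hA'] at h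

variable (S) in
theorem embConst_nonneg (p : ℝ≥0∞) [Fact (1 ≤ p)] : 0 ≤ S.embConst p :=
  Real.iSup_nonneg fun _ => norm_nonneg _

variable [CompleteSpace 𝒜] {q : ℝ≥0∞} [Fact (1 ≤ q)] {f : Ell 𝒩 q → Ell 𝒩 q} {D : Ell 𝒩 q → 𝒜}

theorem HasGradient.sub_eq (hD : S.HasGradient f D) (hc : Continuous D) (x v : Ell 𝒩 q) :
    f (x + v) - f x = S.op q (segmentMean D x v) v := by
  have hderiv : ∀ s : ℝ, HasDerivAt (fun s : ℝ => f (x + s • v)) (S.op q (D (x + s • v)) v) s := by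
    intro s
    rw [hasDerivAt_iff_tendsto_slope_zero]
    simpa only [add_smul, add_assoc] using hD (x + s • v) v
  have hint := intervalIntegral.integral_eq_sub_of_hasDerivAt (a := 0) (b := 1)
    (fun s _ => hderiv s) (Continuous.intervalIntegrable (by fun_prop) _ _)
  have hmap := map_segmentMean hc
    ((ContinuousLinearMap.apply ℝ (Ell 𝒩 q) v).comp (S.op q)) x v
  simp only [one_smul, zero_smul, add_zero] at hint
  exact hint.symm.trans hmap.symm

theorem HasGradient.exists_norm_sub_le (hD : S.HasGradient f D) (hc : Continuous D)
    (hb : BddAbove (Set.range fun z => ‖D z‖)) {p : ℝ≥0∞} [Fact (1 ≤ p)] (x v : Ell 𝒩 q)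
    (w : Ell 𝒩 p) (hw : (w : 𝒩 → ℝ) = v) :
    ∃ u : Ell 𝒩 p, (u : 𝒩 → ℝ) = (f (x + v) - f x : Ell 𝒩 q) ∧
      ‖u‖ ≤ supNorm D * S.embConst p * ‖w‖ := by
  refine ⟨S.op p (segmentMean D x v) w, ?_, ?_⟩
  · rw [hD.sub_eq hc]
    exact S.op_coe_eq _ hw
  · refine ((S.op p _).le_opNorm w).trans ?_
    gcongr
    refine (S.norm_op_le p _).trans ?_
    rw [mul_comm]
    have := S.embConst_nonneg p
    gcongr
    exact norm_segmentMean_le (norm_le_supNorm hb) x v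

theorem le_inner_segmentMean (hc : Continuous D) {m : ℝ}
    (hm : ∀ (x : Ell 𝒩 q) (c : Ell 𝒩 2), m * inner ℝ c c ≤ inner ℝ c (S.op 2 (D x) c))
    (x v : Ell 𝒩 q) (c : Ell 𝒩 2) :
    m * inner ℝ c c ≤ inner ℝ c (S.op 2 (segmentMean D x v) c) := by
  have hmap := map_segmentMean hc
    ((innerSL ℝ c).comp ((ContinuousLinearMap.apply ℝ (Ell 𝒩 2) c).comp (S.op 2))) x v
  change inner ℝ c (S.op 2 (segmentMean D x v) c) =
    ∫ s in (0 : ℝ)..1, inner ℝ c (S.op 2 (D (x + s • v)) c) at hmap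
  rw [hmap]
  have := intervalIntegral.integral_mono (μ := MeasureTheory.volume) (zero_le_one (α := ℝ))
    (f := fun _ => m * inner ℝ c c) (g := fun s => inner ℝ c (S.op 2 (D (x + s • v)) c))
    (Continuous.intervalIntegrable (by fun_prop) _ _)
    (Continuous.intervalIntegrable (by fun_prop) _ _) (fun s => hm _ c)
  simpa using this

theorem HasGradient.exists_inverse (hS : S.AdmitsNormControl) (hf : Continuous f)
    (hD : S.HasGradient f D) (hc : Continuous D) (hb : BddAbove (Set.range fun z => ‖D z‖))
    {m : ℝ} (hm : 0 < m)
    (hmono : ∀ (x : Ell 𝒩 q) (c : Ell 𝒩 2), m * inner ℝ c c ≤ inner ℝ c (S.op 2 (D x) c)) :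
    ∃ (g : Ell 𝒩 q → Ell 𝒩 q) (G : Ell 𝒩 q → 𝒜), Function.LeftInverse g f ∧
      Function.RightInverse g f ∧ S.HasGradient g G ∧ Continuous G ∧
      BddAbove (Set.range fun z => ‖G z‖) := by
  obtain ⟨R, hR0, hR⟩ := hS.exists_isInverse (S := S) (supNorm D) hm
  have hinvD : ∀ x, ∃ B : 𝒜, S.IsInverse (D x) B ∧ ‖B‖ ≤ R := fun x =>
    hR _ (norm_le_supNorm hb x) (hmono x)
  have hinvM : ∀ x v, ∃ B : 𝒜, S.IsInverse (segmentMean D x v) B ∧ ‖B‖ ≤ R := fun x v =>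
    hR _ (norm_segmentMean_le (norm_le_supNorm hb) x v) (le_inner_segmentMean hc hmono x v)
  choose I hI hIR using hinvD
  choose J hJ hJR using hinvM
  set κ := S.embConst q * R
  have hop : ∀ B : 𝒜, ‖B‖ ≤ R → ‖S.op q B‖ ≤ κ := fun B hB =>
    (S.norm_op_le q B).trans (mul_le_mul_of_nonneg_left hB (S.embConst_nonneg q))
  have hκ0 : 0 ≤ κ := mul_nonneg (S.embConst_nonneg q) hR0.le
  have hJf : ∀ x v, S.op q (J x v) (f (x + v) - f x) = v := fun x v => by
    rw [hD.sub_eq hc, (hJ x v).symm.apply_apply]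
  have hsurj : Function.Surjective f := by
    refine surjective_of_tendsto_slope hf hD (R := κ + 1) (by positivity) fun x v =>
      ⟨S.op q (I x) v, (hI x).apply_apply q v, ((S.op q (I x)).le_opNorm v).trans ?_⟩
    gcongr
    linarith [hop _ (hIR x)]
  obtain ⟨g, hg⟩ := hsurj.hasRightInverse
  have hJg : ∀ z w, S.op q (J (g z) (g w - g z)) (w - z) = g w - g z := fun z w => by
    simpa [hg w, hg z] using hJf (g z) (g w - g z)
  have hinj : Function.Injective f := fun x y hxy => by
    have := hJf x (y - x)
    rw [add_sub_cancel, hxy, sub_self, map_zero] at this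
    exact (sub_eq_zero.1 this.symm).symm
  have hglip : LipschitzWith κ.toNNReal g := by
    refine LipschitzWith.of_dist_le_mul fun w z => ?_
    rw [dist_eq_norm, dist_eq_norm, Real.coe_toNNReal _ hκ0, ← hJg]
    exact (S.op q _).le_of_opNorm_le (hop _ (hJR _ _)) _
  have hgc := hglip.continuous
  refine ⟨g, fun z => I (g z), hg.leftInverse_of_injective hinj, hg, ?_, ?_, R, ?_⟩
  · intro z c
    have hv : Continuous fun t : ℝ => g (z + t • c) - g z := by fun_prop
    have hA : Tendsto (fun t : ℝ => segmentMean D (g z) (g (z + t • c) - g z)) (𝓝[≠] 0)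
        (𝓝 (D (g z))) := by
      have h := (continuous_segmentMean hc (g z) hv).tendsto 0
      simp only [zero_smul, add_zero, sub_self, segmentMean_zero] at h
      exact h.mono_left nhdsWithin_le_nhds
    have hB : Tendsto (fun t : ℝ => J (g z) (g (z + t • c) - g z)) (𝓝[≠] 0) (𝓝 (I (g z))) :=
      tendsto_of_isInverse (fun t => hJ _ _) (fun t => hJR _ _) (hI (g z)) hA
    have hBc : Tendsto (fun t : ℝ => S.op q (J (g z) (g (z + t • c) - g z)) c) (𝓝[≠] 0)
        (𝓝 (S.op q (I (g z)) c)) :=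
      (((ContinuousLinearMap.apply ℝ (Ell 𝒩 q) c).comp (S.op q)).continuous.tendsto _).comp hB
    refine hBc.congr' ?_
    filter_upwards [self_mem_nhdsWithin] with t ht
    have h := hJg z (z + t • c)
    rw [add_sub_cancel_left, map_smul] at h
    exact ((inv_smul_eq_iff₀ ht).2 h.symm).symm
  · refine continuous_iff_continuousAt.2 fun z => ?_
    exact tendsto_of_isInverse (fun w => hI (g w)) (fun w => hIR (g w)) (hI (g z))
      ((hc.comp hgc).tendsto z)
  · rintro _ ⟨z, rfl⟩
    exact hIR (g z)

end MatrixAlgebra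

theorem exists_ell_coe_eq {𝒩 : Type*} {p q : ℝ≥0∞} (h : p ≤ q) (y : Ell 𝒩 p) :
    ∃ z : Ell 𝒩 q, (z : 𝒩 → ℝ) = y :=
  ⟨⟨y, (lp.memℓp y).of_exponent_ge h⟩, rfl⟩

theorem mainTheorem5 {𝒩 : Type*} [Countable 𝒩]
    {𝒜 : Type*} [NormedAddCommGroup 𝒜] [NormedSpace ℝ 𝒜] [CompleteSpace 𝒜]
    (S : MatrixAlgebra 𝒩 𝒜) (hnc : S.AdmitsNormControl) (hdecay : S.OffDiagonalDecay)
    (p₀ p : ℝ≥0∞) [Fact (1 ≤ p₀)] [Fact (1 ≤ p)] (hp₀ : 2 ≤ p₀) (hp : p ≤ p₀)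
    (f : Ell 𝒩 p₀ → Ell 𝒩 p₀) (hf : Continuous f) (hf0 : f 0 = 0)
    -- the gradient of `f` is bounded and continuous in `𝒜`
    (D : Ell 𝒩 p₀ → 𝒜) (hD : S.HasGradient f D)
    (hDbdd : BddAbove (Set.range fun z => ‖D z‖)) (hDcont : Continuous D)
    -- strict monotonicity
    (m₀ : ℝ) (hm₀ : 0 < m₀)
    (hmono : ∀ (x : Ell 𝒩 p₀) (c : Ell 𝒩 2), m₀ * inner ℝ c c ≤ inner ℝ c (S.op 2 (D x) c)) :
    -- `g = f⁻¹` on `ℓ^{p₀}`, and its gradient `G` is bounded in `𝒜`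
    ∃ (g : Ell 𝒩 p₀ → Ell 𝒩 p₀) (G : Ell 𝒩 p₀ → 𝒜),
      Function.LeftInverse g f ∧ Function.RightInverse g f ∧
      S.HasGradient g G ∧ BddAbove (Set.range fun z => ‖G z‖) ∧
      ∀ (y ε : Ell 𝒩 p) (x₀ xε : Ell 𝒩 p₀),
        (f x₀ : 𝒩 → ℝ) = y → (f xε : 𝒩 → ℝ) = y + ε →
        -- both solutions belong to `ℓ^p`
        ∃ u₀ uε : Ell 𝒩 p, (u₀ : 𝒩 → ℝ) = x₀ ∧ (uε : 𝒩 → ℝ) = xε ∧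
          ‖uε - u₀‖ ≤ supNorm G * S.embConst p * ‖ε‖ ∧
          (y ≠ 0 → u₀ ≠ 0 ∧
            ‖uε - u₀‖ / ‖u₀‖ ≤ condNumber D G * S.embConst p ^ 2 * (‖ε‖ / ‖y‖)) := by
  obtain ⟨g, G, hgf, hfg, hG, hGc, hGb⟩ := hD.exists_inverse hnc hf hDcont hDbdd hm₀ hmono
  have hg0 : g 0 = 0 := by simpa [hf0] using hgf 0
  refine ⟨g, G, hgf, hfg, hG, hGb, fun y ε x₀ xε hx₀ hxε => ?_⟩
  obtain ⟨ε', hε'⟩ := exists_ell_coe_eq hp ε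
  obtain ⟨u₀, hu₀, -⟩ := hG.exists_norm_sub_le hGc hGb 0 (f x₀) y hx₀.symm
  obtain ⟨w, hw, hwle⟩ := hG.exists_norm_sub_le hGc hGb (f x₀) ε' ε hε'.symm
  rw [zero_add, hg0, sub_zero, hgf] at hu₀
  have hsum : f x₀ + ε' = f xε := by
    apply lp.ext
    rw [lp.coeFn_add, hx₀, hε', hxε]
  rw [hsum, hgf, hgf] at hw
  refine ⟨u₀, u₀ + w, hu₀, ?_, by simpa using hwle, fun hy => ?_⟩
  · rw [lp.coeFn_add, hu₀, hw, lp.coeFn_sub, add_sub_cancel]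
  obtain ⟨y', hy', hyle⟩ := hD.exists_norm_sub_le hDcont hDbdd 0 x₀ u₀ hu₀
  rw [zero_add, hf0, sub_zero, hx₀] at hy'
  obtain rfl : y' = y := lp.ext hy'
  have hypos : 0 < ‖y'‖ := norm_pos_iff.2 hy
  have hu : u₀ ≠ 0 := by
    rintro rfl
    simp only [norm_zero, mul_zero] at hyle
    linarith
  have hupos : 0 < ‖u₀‖ := norm_pos_iff.2 hu
  refine ⟨hu, ?_⟩
  rw [add_sub_cancel_left, div_le_iff₀ hupos]
  have hE := S.embConst_nonneg p
  have hGs := supNorm_nonneg G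
  calc ‖w‖ ≤ supNorm G * S.embConst p * ‖ε‖ * 1 := by simpa using hwle
    _ ≤ supNorm G * S.embConst p * ‖ε‖ * (supNorm D * S.embConst p * ‖u₀‖ / ‖y'‖) := by
        gcongr
        rwa [one_le_div hypos]
    _ = condNumber D G * S.embConst p ^ 2 * (‖ε‖ / ‖y'‖) * ‖u₀‖ := by
        rw [condNumber]
        ring
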